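/- Let $R$ be a commutative $\mathbb{Q}$-algebra (for example $\mathbb{C}$, or the ring $\mathbb{C}[x_1^{\pm1},\dots,x_N^{\pm1}]$ with indeterminates $x_i$). Let $\mathcal{M}=R[a_{-1},a_{-2},\dots]$ be the Fock space with vacuum $|0\rangle=1$. For $n\ge 1$ the operator $a_{-n}$ acts by multiplication and $a_n$ acts as $n\,\partial/\partial a_{-n}$, so that $[a_m,a_n]=m\,\delta_{m,-n}$. Let $\langle 0|$ be the linear functional on $\mathcal{M}$ with $\langle 0|0\rangle=1$ and $\langle 0|a_{-n}=0$ for $n\ge1$. Operators on $\mathcal{M}$ act on linear functionals from the right by composition. Define operators $W_n,W^*_n$ $(n\in\mathbb{Z})$ on $\mathcal{M}$ by $$W(z)=(1-z^2)\exp\Big(\sum_{n\ge1}\frac{a_{-n}}{n}z^n\Big)\exp\Big(-\sum_{n\ge1}\frac{a_n}{n}(z^{-n}+z^n)\Big)=\sum_{n\in\mathbb{Z}}W_nz^{-n},$$ $$W^*(z)=\exp\Big(-\sum_{n\ge1}\frac{a_{-n}}{n}z^n\Big)\exp\Big(\sum_{n\ge1}\frac{a_n}{n}(z^{-n}+z^n)\Big)=\sum_{n\in\mathbb{Z}}W^*_nz^{n}.$$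 A generalized partition is a finite weakly decreasing sequence of nonnegative integers (zero parts are kept and counted). For a generalized partition $\nu=(\nu_1,\dots,\nu_k)$ put $$|\nu^{\rm o}\rangle=W_{-\nu_1}W_{-\nu_2}\cdots W_{-\nu_k}|0\rangle,\qquad \langle\nu^{\rm o}|=\langle0|W^*_{-\nu_k}\cdots W^*_{-\nu_1}.$$ Let $l,N\ge 0$, and let $x_1,\dots,x_N$ be units of $R$. Put $\Gamma_+(y)=\exp\big(\sum_{n\ge1}\frac{a_n}{n}y^n\big)$ and $\Gamma_+(\{x^{\pm}\})=\prod_{i=1}^N\Gamma_+(x_i)\Gamma_+(x_i^{-1})$. Define $h_n(x^{\pm})$, $n\in\mathbb{Z}$, by $\prod_{i=1}^N\frac{1}{(1-x_iz)(1-x_i^{-1}z)}=\sum_{n\in\mathbb{Z}}h_n(x^{\pm})z^n$, so that $h_n(x^\pm)=0$ for $n<0$. **Proposition.** For all generalized partitions $\mu=(\mu_1,\dots,\mu_l)$ and $\lambda=(\lambda_1,\dots,\lambda_{l+N})$, the skew orthogonal Schur function ${\rm o}_{\lambda/\mu}(x^{\pm}):=\langle\mu^{\rm o}|\Gamma_+(\{x^{\pm}\})|\lambda^{\rm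 o}\rangle$ satisfies $$\langle\mu^{\rm o}|\Gamma_+(\{x^{\pm}\})|\lambda^{\rm o}\rangle=\det(b_{ij})_{i,j=1}^{l+N},$$ where $$b_{ij}=\begin{cases}h_{\lambda_i-\mu_j-i+j}(x^{\pm}), & 1\le j\le l,\\ h_{\lambda_i-i+j}(x^{\pm})-h_{\lambda_i-i-j+2l}(x^{\pm}), & l+1\le j\le l+N.\end{cases}$$ -/

import Mathlib

namespace FockSpace

noncomputable section

/-! ### Locally finite sums and exponentials of linear operators -/

section Operators

variable {S M P : Type*} [CommRing S] [AddCommGroup M] [Module S M] [AddCommGroup P] [Module S P]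

/-- The sum `∑ i, f i` of a family of linear maps of which only finitely many are nonzero on any
given vector. -/
def locallyFiniteSum {ι : Type*} (f : ι → M →ₗ[S] P)
    (hf : ∀ v, (Function.support fun i => f i v).Finite) : M →ₗ[S] P where
  toFun v := ∑ᶠ i, f i v
  map_add' v w := by
    simp only [map_add]
    exact finsum_add_distrib (hf v) (hf w)
  map_smul' r v := by
    simp only [map_smul, RingHom.id_apply]
    exact (smul_finsum' r (hf v)).symm

variable [Algebra ℚ S]

theorem finite_support_exp (T : Module.End S M) (hT : ∀ v, ∃ k, (T ^ k) v = 0) (v : M) :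
    (Function.support fun k : ℕ =>
      (algebraMap ℚ S ((k.factorial : ℚ)⁻¹) • T ^ k) v).Finite := by
  obtain ⟨k, hk⟩ := hT v
  refine (Set.finite_lt_nat k).subset fun m hm => ?_
  by_contra hlt
  have hle : k ≤ m := not_lt.mp hlt
  apply hm
  obtain ⟨d, rfl⟩ := Nat.exists_eq_add_of_le' hle
  simp [pow_add, hk]

/-- The exponential `∑ k, T ^ k / k!` of a locally nilpotent linear operator `T`. -/
def locallyNilpotentExp (T : Module.End S M) (hT : ∀ v, ∃ k, (T ^ k) v = 0) : Module.End S M :=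
  locallyFiniteSum (fun k : ℕ => algebraMap ℚ S ((k.factorial : ℚ)⁻¹) • T ^ k)
    (finite_support_exp T hT)

/-- The exponential `∑ k, F ^ k / k!` of a formal power series `F` without constant term whose
coefficients are linear operators (`F ^ k` does not contribute to the coefficient of `z ^ m` for
`m < k`). -/
def powerSeriesExp (F : PowerSeries (Module.End S M)) : PowerSeries (Module.End S M) :=
  PowerSeries.mk fun m =>
    ∑ k ∈ Finset.range (m + 1), algebraMap ℚ S ((k.factorial : ℚ)⁻¹) • PowerSeries.coeff m (F ^ k)

end Operators

/-! ### The Fock space and the Heisenberg operators -/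

/-- The Fock space, with scalars in `S`: the polynomial ring in the variables `a_{-n}`, `n ≥ 1`,
with `a_{-n}` written `X n` and the vacuum `|0⟩` written `1`. -/
abbrev Fock (S : Type*) [CommRing S] : Type _ := MvPolynomial ℕ+ S

section Heisenberg

variable {S : Type*} [CommRing S]

/-- The operator `a_{-n}`, `n ≥ 1`. -/
def create (n : ℕ+) : Module.End S (Fock S) := LinearMap.mulLeft S (MvPolynomial.X n)

/-- The operator `a_n`, `n ≥ 1`, that is `n ∂/∂a_{-n}`. -/
def annihilate (n : ℕ+) : Module.End S (Fock S) :=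
  ((n : ℕ) : S) • (MvPolynomial.pderiv n).toLinearMap

/-- The Heisenberg relation `[a_m, a_{-n}] = m δ_{m,n}`. -/
theorem annihilate_create (m n : ℕ+) (v : Fock S) :
    annihilate m (create n v) - create n (annihilate m v)
      = if m = n then ((m : ℕ) : S) • v else 0 := by
  by_cases h : m = n
  · subst h
    simp [annihilate, create, Derivation.leibniz, smul_add]
  · have h' : n ≠ m := fun e => h e.symm
    simp [annihilate, create, Derivation.leibniz, MvPolynomial.pderiv_X_of_ne h', h]

/-- `⟨0| : M → S`, the linear functional with `⟨0|0⟩ = 1` and `⟨0|a_{-n} = 0` for `n ≥ 1`. -/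
def braVacuum : Fock S →ₗ[S] S := MvPolynomial.lcoeff S 0

variable [Algebra ℚ S]

theorem finite_support_annihilationSum (c : ℕ+ → S) (v : Fock S) :
    (Function.support fun n : ℕ+ =>
      ((algebraMap ℚ S (((n : ℕ) : ℚ)⁻¹) * c n) • annihilate (S := S) n) v).Finite := by
  classical
  refine (v.vars.finite_toSet).subset fun n hn => ?_
  by_contra hv
  exact hn (by simp [annihilate, MvPolynomial.pderiv_eq_zero_of_notMem_vars (by simpa using hv)])

/-- The operator `∑_{n ≥ 1} (a_n / n) c_n` for scalars `c_n`. -/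
def annihilationSum (c : ℕ+ → S) : Module.End S (Fock S) :=
  locallyFiniteSum
    (fun n : ℕ+ => (algebraMap ℚ S (((n : ℕ) : ℚ)⁻¹) * c n) • annihilate n)
    (finite_support_annihilationSum c)

theorem annihilationSum_mul_X (c : ℕ+ → S) (v : Fock S) (m : ℕ+) :
    annihilationSum c (v * MvPolynomial.X m)
      = annihilationSum c v * MvPolynomial.X m + c m • v := by
  have key : ∀ n : ℕ+,
      ((algebraMap ℚ S (((n : ℕ) : ℚ)⁻¹) * c n) • annihilate (S := S) n) (v * MvPolynomial.X m)
        = ((algebraMap ℚ S (((n : ℕ) : ℚ)⁻¹) * c n) • annihilate (S := S) n) v * MvPolynomial.X m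
          + if n = m then c m • v else 0 := by
    intro n
    by_cases h : n = m
    · subst h
      have hn : algebraMap ℚ S (((n : ℕ) : ℚ)⁻¹) * ((n : ℕ) : S) = 1 := by
        rw [← map_natCast (algebraMap ℚ S), ← map_mul, inv_mul_cancel₀ (by positivity), map_one]
      have hs : algebraMap ℚ S (((n : ℕ) : ℚ)⁻¹) * c n * ((n : ℕ) : S) = c n := by
        rw [mul_right_comm, hn, one_mul]
      simp only [annihilate, LinearMap.smul_apply, smul_smul, hs, Derivation.coeFn_coe, Derivation.leibniz, MvPolynomial.pderiv_X_self, if_true, smul_add,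
        smul_eq_mul, mul_one, MvPolynomial.smul_eq_C_mul]
      ring
    · simp only [annihilate, LinearMap.smul_apply, smul_smul, Derivation.coeFn_coe, Derivation.leibniz, if_neg h,
        MvPolynomial.pderiv_X_of_ne (fun e => h e.symm), add_zero,
        smul_eq_mul, MvPolynomial.smul_eq_C_mul]
      ring
  have h1 := finite_support_annihilationSum c v
  have h2 : (Function.support fun n : ℕ+ => if n = m then c m • v else 0).Finite :=
    (Set.finite_singleton m).subset fun n hn => by
      by_contra hne
      exact hn (if_neg hne)
  change ∑ᶠ n, _ = (∑ᶠ n, _) * _ + _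
  rw [finsum_congr key, finsum_add_distrib (h1.subset ?_) h2, finsum_mul' _ _ h1,
    finsum_eq_single (fun n : ℕ+ => if n = m then c m • v else 0) m (fun n hn => if_neg hn),
    if_pos rfl]
  intro n hn hz
  exact hn (by simp only [hz, zero_mul])

theorem annihilationSum_locallyNilpotent (c : ℕ+ → S) (v : Fock S) :
    ∃ k, (annihilationSum c ^ k) v = 0 := by
  have hup : ∀ (w : Fock S) (k d : ℕ), (annihilationSum c ^ k) w = 0 →
      (annihilationSum c ^ (k + d)) w = 0 := by
    intro w k d h
    rw [add_comm, pow_add, Module.End.mul_apply, h, map_zero]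
  induction v using MvPolynomial.induction_on with
  | C r =>
    refine ⟨1, ?_⟩
    change ∑ᶠ n, _ = _
    simp [annihilate]
  | add p q hp hq =>
    obtain ⟨k, hk⟩ := hp
    obtain ⟨m, hm⟩ := hq
    refine ⟨k + m, ?_⟩
    rw [map_add, hup p k m hk, add_comm k m, hup q m k hm, add_zero]
  | mul_X p m hp =>
    have hX : ∀ j, (annihilationSum c ^ (j + 1)) (p * MvPolynomial.X m)
        = (annihilationSum c ^ (j + 1)) p * MvPolynomial.X m
          + ((j + 1 : ℕ) : S) • c m • (annihilationSum c ^ j) p := by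
      intro j
      induction j with
      | zero => simp [annihilationSum_mul_X]
      | succ j ih =>
        rw [pow_succ', Module.End.mul_apply, ih, map_add, annihilationSum_mul_X, map_smul,
          map_smul, ← Module.End.mul_apply, ← pow_succ', ← Module.End.mul_apply, ← pow_succ',
          add_assoc, Nat.cast_succ (j + 1), add_smul, one_smul, add_comm (c m • _)]
    obtain ⟨k, hk⟩ := hp
    exact ⟨k + 1, by rw [hX, hup p k 1 hk, hk]; simp⟩

/-- The operator `exp (∑_{n ≥ 1} (a_n / n) c_n)` for scalars `c_n`. -/
def annihilationExp (c : ℕ+ → S) : Module.End S (Fock S) :=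
  locallyNilpotentExp (annihilationSum c) (annihilationSum_locallyNilpotent c)

/-- The operator-valued formal power series `exp (ε ∑_{n ≥ 1} (a_{-n} / n) z ^ n)`. -/
def creationExp (ε : S) : PowerSeries (Module.End S (Fock S)) :=
  powerSeriesExp (PowerSeries.mk fun n =>
    if h : 0 < n then (ε * algebraMap ℚ S ((n : ℚ)⁻¹)) • create ⟨n, h⟩ else 0)

/-- The half vertex operator `Γ₊(y) = exp (∑_{n ≥ 1} (a_n / n) y ^ n)`. -/
def Gamma (y : S) : Module.End S (Fock S) := annihilationExp fun n => y ^ (n : ℕ)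

/-- `Γ₊({x^±}) = ∏ i, Γ₊(x_i) Γ₊(x_i⁻¹)`. -/
def GammaPM {N : ℕ} (x : Fin N → Sˣ) : Module.End S (Fock S) :=
  (List.ofFn fun i => Gamma ((x i : Sˣ) : S) * Gamma (((x i)⁻¹ : Sˣ) : S)).prod

end Heisenberg

/-! ### The vertex operators -/

section VertexOperators

open LaurentPolynomial

variable {R : Type*} [CommRing R]

/-- The coefficient of `z ^ k` of a vector whose coordinates are Laurent polynomials in `z`. -/
def zCoeff (k : ℤ) : Fock R[T;T⁻¹] →ₗ[R] Fock R where
  toFun u := AddMonoidAlgebra.map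
    ((Finsupp.applyAddHom k).comp
      (AddMonoidAlgebra.coeffAddEquiv (R := R) (M := ℤ)).toAddMonoidHom) u
  map_add' u v := AddMonoidAlgebra.map_add _ u v
  map_smul' r v := by
    ext d
    rfl

theorem finite_support_zCoeff (u : Fock R[T;T⁻¹]) :
    (Function.support fun k : ℤ => zCoeff k u).Finite := by
  classical
  refine (u.support.biUnion fun d => (MvPolynomial.coeff d u).coeff.support).finite_toSet.subset
    fun k hk => ?_
  by_contra hn
  apply hk
  ext d
  change (MvPolynomial.coeff d u).coeff k = 0
  by_contra h
  refine hn (Finset.mem_coe.2 (Finset.mem_biUnion.2 ⟨d, ?_, Finsupp.mem_support_iff.2 h⟩))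
  rw [MvPolynomial.mem_support_iff]
  intro h0
  rw [h0] at h
  exact h rfl

/-- Extension of scalars from `R` to `R[z, z⁻¹]`. -/
def extendScalars : Fock R →ₗ[R] Fock R[T;T⁻¹] where
  toFun := MvPolynomial.map LaurentPolynomial.C
  map_add' := map_add _
  map_smul' r v := by
    ext d
    simp [MvPolynomial.coeff_map, LaurentPolynomial.smul_eq_C_mul]

theorem finite_support_modes (A : PowerSeries (Module.End R (Fock R)))
    (B : Fock R →ₗ[R] Fock R[T;T⁻¹]) (k : ℤ) (v : Fock R) :
    (Function.support fun r : ℕ =>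
      (PowerSeries.coeff r A ∘ₗ zCoeff (k - r) ∘ₗ B) v).Finite := by
  have hinj : Set.InjOn (fun r : ℕ => k - (r : ℤ))
      ((fun r : ℕ => k - (r : ℤ)) ⁻¹' Function.support fun j : ℤ => zCoeff j (B v)) :=
    fun a _ b _ h => by simpa using h
  refine ((finite_support_zCoeff (B v)).preimage hinj).subset fun r hr h0 => hr ?_
  have h0' : zCoeff (k - (r : ℤ)) (B v) = 0 := h0
  simp only [LinearMap.comp_apply, h0', map_zero]

/-- The coefficient of `z ^ k` in `A(z) B(z)`, for an operator-valued power series `A(z)` and an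
operator `B(z)` that sends each vector to a Laurent polynomial in `z` with vector coefficients. -/
def productCoeff (A : PowerSeries (Module.End R (Fock R)))
    (B : Fock R →ₗ[R] Fock R[T;T⁻¹]) (k : ℤ) : Module.End R (Fock R) :=
  locallyFiniteSum (fun r : ℕ => PowerSeries.coeff r A ∘ₗ zCoeff (k - r) ∘ₗ B)
    (finite_support_modes A B k)

variable [Algebra ℚ R]

/-- `v ↦ p(z) exp (ε ∑_{n ≥ 1} (a_n / n) (z ^ (-n) + z ^ n)) v`, for a Laurent polynomial `p`. -/
def annihilationHalf (p : R[T;T⁻¹]) (ε : R) : Fock R →ₗ[R] Fock R[T;T⁻¹] :=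
  (p • annihilationExp fun n : ℕ+ =>
    LaurentPolynomial.C ε * (T (-((n : ℕ) : ℤ)) + T ((n : ℕ) : ℤ))).restrictScalars R ∘ₗ
      extendScalars

/-- The modes `W_n` of
`W(z) = (1 - z²) exp (∑ (a_{-n}/n) z^n) exp (-∑ (a_n/n) (z^{-n} + z^n)) = ∑ W_n z^{-n}`. -/
def W (n : ℤ) : Module.End R (Fock R) :=
  productCoeff (creationExp 1) (annihilationHalf (1 - T 2) (-1)) (-n)

/-- The modes `W*_n` of
`W*(z) = exp (-∑ (a_{-n}/n) z^n) exp (∑ (a_n/n) (z^{-n} + z^n)) = ∑ W*_n z^n`. -/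
def WStar (n : ℤ) : Module.End R (Fock R) :=
  productCoeff (creationExp (-1)) (annihilationHalf 1 1) n

/-- `|λ^o⟩ = W_{-λ₁} W_{-λ₂} ⋯ W_{-λₙ} |0⟩`. -/
def ketO {n : ℕ} (lam : Fin n → ℕ) : Fock R :=
  (List.ofFn fun i => W (R := R) (-(lam i : ℤ))).prod 1

/-- `⟨μ^o| = ⟨0| W*_{-μₗ} ⋯ W*_{-μ₁}`. An element of the completion of the dual Fock space is the
same as a linear functional on the Fock space; operators act on functionals from the right by
composition. -/
def braO {l : ℕ} (mu : Fin l → ℕ) : Fock R →ₗ[R] R :=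
  braVacuum ∘ₗ (List.ofFn fun i : Fin l => WStar (R := R) (-(mu i.rev : ℤ))).prod

/-- The skew orthogonal Schur function
`o_{λ/μ}(x^±) = ⟨μ^o| Γ₊({x^±}) |λ^o⟩`. -/
def skewOrthogonalSchur {l n N : ℕ} (x : Fin N → Rˣ) (lam : Fin n → ℕ) (mu : Fin l → ℕ) : R :=
  braO mu (GammaPM x (ketO lam))

end VertexOperators

/-- `h_n(x^±)`, `n ∈ ℤ`: the coefficient of `z ^ n` in `∏ i, 1 / ((1 - x_i z) (1 - x_i⁻¹ z))`. -/
def hPM {R : Type*} [CommRing R] {N : ℕ} (x : Fin N → Rˣ) (n : ℤ) : R :=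
  if 0 ≤ n then
    PowerSeries.coeff n.toNat (PowerSeries.invOfUnit
      (∏ i, (1 - PowerSeries.C ((x i : Rˣ) : R) * PowerSeries.X) *
        (1 - PowerSeries.C (((x i)⁻¹ : Rˣ) : R) * PowerSeries.X)) 1)
  else 0

end

end FockSpace

/-! Write `H(w) = vertexSeries 1 = exp(∑ a_{-n} w^n / n)` with coefficients `H_r`, zero for `r < 0`.
By Taylor's formula the exponential of an annihilation sum is the algebra map translating each
`a_{-n}` by a scalar, so it multiplies `H(w)` by a scalar series. For the two halves used in `W(z)`
and `W*(z)` that series is `q(w)` and `1/q(w)` respectively, where `q(w) = (1 - zw)(1 - w/z)`; for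
`Γ₊({x^±})` it is `g(w) = ∑ h_n(x^±) w^n`.

Multiplication by `q` is a three-term combination of neighbouring coefficients, and in these
determinants such combinations are column operations. Hence `W_{-k}` merely adds a row, and `|λ^o⟩ =
det(H_{λ_i-i+j} - H_{λ_i-i-j})` (`W_apply_orthogonalDet`, `ketO_eq_orthogonalDet`). Applying `Γ₊`
replaces `H` by `F = H g`.

On the bra side, each `W*_{-μ_j}` turns one `F`-column into a column of scalars `g_{λ_i-i+j-μ_j}`
and raises the reflection offset of the later columns by 2 (`WStar_apply_mixedDet`). The exceptional
column is governed by `(1 - w²)/q(w) = ∑_k z^k w^|k|`: its contribution to the mode is a coefficient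
of `H⁻¹F = g`. After `l` steps the vacuum functional sends `H` to 1, so every remaining `F_r`
becomes `h_r(x^±)`. -/

namespace FockSpace

noncomputable section

/-! ### Exponentials of power series over a commutative ℚ-algebra -/

section ExpSeries

open PowerSeries

variable {A B : Type*} [CommRing A] [CommRing B] [Algebra ℚ A] [Algebra ℚ B]

/-- The exponential of a power series without constant term over a commutative ring. -/
def expSeries (G : PowerSeries A) : PowerSeries A :=
  PowerSeries.mk fun m =>
    ∑ k ∈ Finset.range (m + 1), algebraMap ℚ A ((k.factorial : ℚ)⁻¹) * PowerSeries.coeff m (G ^ k)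

theorem map_expSeries (φ : A →+* B) (G : PowerSeries A) :
    PowerSeries.map φ (expSeries G) = expSeries (PowerSeries.map φ G) := by
  ext m
  simp [expSeries, ← map_pow, PowerSeries.coeff_map, RingHom.map_rat_algebraMap]

theorem constantCoeff_expSeries (G : PowerSeries A) :
    PowerSeries.constantCoeff (expSeries G) = 1 := by
  rw [← PowerSeries.coeff_zero_eq_constantCoeff_apply]
  simp [expSeries]

omit [Algebra ℚ A] in
theorem coeff_pow_eq_zero_of_lt {G : PowerSeries A} (hG : PowerSeries.constantCoeff G = 0)
    {m k : ℕ} (h : m < k) : PowerSeries.coeff m (G ^ k) = 0 := by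
  have : (PowerSeries.X : PowerSeries A) ^ k ∣ G ^ k :=
    pow_dvd_pow_of_dvd (PowerSeries.X_dvd_iff.2 hG) k
  exact PowerSeries.X_pow_dvd_iff.1 this m h

/-- Terms beyond degree `m` contribute nothing, so one truncation serves all coefficients up to `n`;
this allows a finite sum to be differentiated. -/
theorem coeff_expSeries {G : PowerSeries A} (hG : PowerSeries.constantCoeff G = 0)
    {m n : ℕ} (h : m ≤ n) : PowerSeries.coeff m (expSeries G) =
      PowerSeries.coeff m (∑ k ∈ Finset.range (n + 1),
        PowerSeries.C (algebraMap ℚ A ((k.factorial : ℚ)⁻¹)) * G ^ k) := by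
  simp only [expSeries, PowerSeries.coeff_mk, map_sum, PowerSeries.coeff_C_mul]
  refine Finset.sum_subset (Finset.range_mono (by omega)) fun k _ hk => ?_
  rw [coeff_pow_eq_zero_of_lt hG (by simpa using hk), mul_zero]

theorem derivative_expSeries {G : PowerSeries A} (hG : PowerSeries.constantCoeff G = 0) :
    PowerSeries.derivative A (expSeries G) = PowerSeries.derivative A G * expSeries G := by
  ext m
  rw [PowerSeries.coeff_derivative, coeff_expSeries hG (le_refl (m + 1)),
    ← PowerSeries.coeff_derivative, map_sum, Finset.sum_range_succ']
  have h1 : ∀ k : ℕ, PowerSeries.derivative A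
      (PowerSeries.C (algebraMap ℚ A (((k + 1).factorial : ℚ)⁻¹)) * G ^ (k + 1)) =
      PowerSeries.derivative A G *
        (PowerSeries.C (algebraMap ℚ A ((k.factorial : ℚ)⁻¹)) * G ^ k) := by
    intro k
    have h2 : algebraMap ℚ A (((k + 1).factorial : ℚ)⁻¹) * ((k + 1 : ℕ) : A)
        = algebraMap ℚ A ((k.factorial : ℚ)⁻¹) := by
      rw [← map_natCast (algebraMap ℚ A), ← map_mul, Nat.factorial_succ]
      congr 1
      push_cast
      field_simp
    rw [← h2, Derivation.leibniz, Derivation.leibniz_pow, PowerSeries.derivative_C]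
    simp only [smul_eq_mul, mul_zero, add_zero, nsmul_eq_mul, map_mul, map_natCast,
      Nat.add_sub_cancel]
    ring
  simp only [h1]
  rw [← Finset.mul_sum]
  simp only [Nat.factorial_zero, Nat.cast_one, inv_one, map_one, pow_zero, mul_one,
    Derivation.map_one_eq_zero, add_zero, PowerSeries.coeff_mul]
  refine Finset.sum_congr rfl fun p hp => ?_
  rw [coeff_expSeries hG (n := m)
    (by have := Finset.HasAntidiagonal.mem_antidiagonal.1 hp; omega)]

/-- A ℚ-algebra is torsion-free, so a series is determined by its derivative and constant term. The
exponential identities below all reduce to this. -/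
theorem eq_one_of_derivative_eq_zero {Y : PowerSeries A} (h : PowerSeries.derivative A Y = 0)
    (h0 : PowerSeries.constantCoeff Y = 1) : Y = 1 := by
  have := IsAddTorsionFree.of_module_rat (M := A)
  refine PowerSeries.derivative.ext ?_ (by simpa using h0)
  simp [h]

theorem expSeries_neg_mul {G : PowerSeries A} (hG : PowerSeries.constantCoeff G = 0) :
    expSeries (-G) * expSeries G = 1 := by
  refine eq_one_of_derivative_eq_zero ?_ (by simp [constantCoeff_expSeries])
  rw [Derivation.leibniz, derivative_expSeries hG, derivative_expSeries (by simpa using hG)]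
  simp only [smul_eq_mul, map_neg]
  ring

theorem expSeries_add {F G : PowerSeries A} (hF : PowerSeries.constantCoeff F = 0)
    (hG : PowerSeries.constantCoeff G = 0) :
    expSeries (F + G) = expSeries F * expSeries G := by
  have h : expSeries (F + G) * (expSeries (-F) * expSeries (-G)) = 1 := by
    refine eq_one_of_derivative_eq_zero ?_ (by simp [constantCoeff_expSeries])
    rw [Derivation.leibniz, Derivation.leibniz,
      derivative_expSeries (G := F + G) (by rw [map_add, hF, hG, add_zero]),
      derivative_expSeries (G := -F) (by simpa using hF),
      derivative_expSeries (G := -G) (by simpa using hG)]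
    simp only [smul_eq_mul, map_neg, map_add]
    ring
  calc expSeries (F + G) = expSeries (F + G) * ((expSeries (-F) * expSeries F) *
        (expSeries (-G) * expSeries G)) := by
          rw [expSeries_neg_mul hF, expSeries_neg_mul hG]; ring
    _ = (expSeries (F + G) * (expSeries (-F) * expSeries (-G))) * (expSeries F * expSeries G) := by
          ring
    _ = _ := by rw [h, one_mul]

/-- The series `∑_{n ≥ 1} c_n z ^ n / n`. -/
def logSeries (c : ℕ → A) : PowerSeries A :=
  PowerSeries.mk fun n => algebraMap ℚ A ((n : ℚ)⁻¹) * c n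

omit [Algebra ℚ A] [Algebra ℚ B] in
theorem constantCoeff_map_eq_zero (φ : A →+* B) {G : PowerSeries A}
    (hG : PowerSeries.constantCoeff G = 0) :
    PowerSeries.constantCoeff (PowerSeries.map φ G) = 0 := by
  rw [← PowerSeries.coeff_zero_eq_constantCoeff_apply, PowerSeries.coeff_map,
    PowerSeries.coeff_zero_eq_constantCoeff_apply, hG, map_zero]

/-- The convention `0⁻¹ = 0` in ℚ removes the term `c 0`, so sequences such as `y ^ n` may be used
without correction at `n = 0`. -/
theorem constantCoeff_logSeries (c : ℕ → A) : PowerSeries.constantCoeff (logSeries c) = 0 := by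
  rw [← PowerSeries.coeff_zero_eq_constantCoeff_apply]
  simp [logSeries]

theorem derivative_logSeries (c : ℕ → A) :
    PowerSeries.derivative A (logSeries c) = PowerSeries.mk fun n => c (n + 1) := by
  ext n
  have h : algebraMap ℚ A (((n + 1 : ℕ) : ℚ)⁻¹) * ((n + 1 : ℕ) : A) = 1 := by
    rw [← map_natCast (algebraMap ℚ A), ← map_mul, inv_mul_cancel₀ (by positivity), map_one]
  rw [PowerSeries.coeff_derivative, logSeries, PowerSeries.coeff_mk, PowerSeries.coeff_mk]
  push_cast at h ⊢
  linear_combination c (n + 1) * h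

/-- The exponent is `-log(1 - yz)`: its derivative times `1 - yz` is `y`, so the product has
derivative zero. -/
theorem expSeries_logSeries_pow (y : A) :
    expSeries (logSeries fun n => y ^ n) * (1 - PowerSeries.C y * PowerSeries.X) = 1 := by
  refine eq_one_of_derivative_eq_zero ?_ (by simp [constantCoeff_expSeries])
  have h : PowerSeries.derivative A (logSeries fun n => y ^ n) *
      (1 - PowerSeries.C y * PowerSeries.X) = PowerSeries.C y := by
    rw [derivative_logSeries]
    ext n
    cases n with
    | zero => simp [mul_sub]
    | succ n =>
      rw [mul_sub, mul_one, ← mul_assoc, map_sub, PowerSeries.coeff_succ_mul_X,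
        mul_comm, PowerSeries.coeff_C_mul, PowerSeries.coeff_C]
      simp
      ring
  rw [Derivation.leibniz, derivative_expSeries (constantCoeff_logSeries _)]
  simp only [map_sub, Derivation.leibniz, PowerSeries.derivative_C, Derivation.map_one_eq_zero,
    PowerSeries.derivative_X, smul_eq_mul]
  linear_combination (expSeries (logSeries fun n => y ^ n)) * h

end ExpSeries

/-! ### Annihilation exponentials as translations -/

section Shift

variable {S : Type*} [CommRing S] [Algebra ℚ S]

theorem annihilationSum_pow_succ_mul_X (c : ℕ+ → S) (p : Fock S) (m : ℕ+) (j : ℕ) :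
    (annihilationSum c ^ (j + 1)) (p * MvPolynomial.X m)
      = (annihilationSum c ^ (j + 1)) p * MvPolynomial.X m
        + ((j + 1 : ℕ) : S) • c m • (annihilationSum c ^ j) p := by
  induction j with
  | zero => simp [annihilationSum_mul_X]
  | succ j ih =>
    rw [pow_succ', Module.End.mul_apply, ih, map_add, annihilationSum_mul_X, map_smul,
      map_smul, ← Module.End.mul_apply, ← pow_succ', ← Module.End.mul_apply, ← pow_succ',
      add_assoc, Nat.cast_succ (j + 1), add_smul, one_smul, add_comm (c m • _)]

theorem locallyNilpotentExp_apply {M : Type*} [AddCommGroup M] [Module S M] (T : Module.End S M)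
    (hT : ∀ v, ∃ k, (T ^ k) v = 0) (v : M) (k : ℕ) (hk : (T ^ k) v = 0) :
    locallyNilpotentExp T hT v =
      ∑ j ∈ Finset.range k, algebraMap ℚ S ((j.factorial : ℚ)⁻¹) • (T ^ j) v := by
  change ∑ᶠ j : ℕ, (algebraMap ℚ S ((j.factorial : ℚ)⁻¹) • T ^ j) v = _
  refine (finsum_eq_sum_of_support_subset _ fun j hj => ?_)
  rw [Finset.coe_range, Set.mem_Iio]
  by_contra hlt
  obtain ⟨d, rfl⟩ := Nat.exists_eq_add_of_le' (not_lt.mp hlt)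
  exact hj (by simp [pow_add, hk])

/-- Since `T = annihilationSum c` satisfies `[T, X m] = c m`, conjugation by `exp T` translates `X
m` by `c m`. -/
theorem annihilationExp_mul_X (c : ℕ+ → S) (p : Fock S) (m : ℕ+) :
    annihilationExp c (p * MvPolynomial.X m)
      = annihilationExp c p * (MvPolynomial.X m + MvPolynomial.C (c m)) := by
  obtain ⟨k, hk⟩ := annihilationSum_locallyNilpotent c p
  have hk1 : (annihilationSum c ^ (k + 1)) p = 0 := by
    rw [pow_succ', Module.End.mul_apply, hk, map_zero]
  have hk2 : (annihilationSum c ^ (k + 1)) (p * MvPolynomial.X m) = 0 := by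
    rw [annihilationSum_pow_succ_mul_X, hk, hk1]
    simp
  have e := fun (v : Fock S) => locallyNilpotentExp_apply (annihilationSum c)
    (annihilationSum_locallyNilpotent c) v
  -- The two copies of `exp T p` are cut at different lengths, `k + 1` and `k`, so that the term `j
  -- + 1` of the commutator matches the term `j` of the second copy.
  rw [annihilationExp, e _ _ hk2, mul_add]
  nth_rw 1 [e _ _ hk1]
  rw [e _ _ hk, Finset.sum_range_succ', Finset.sum_range_succ' (n := k)]
  simp only [annihilationSum_pow_succ_mul_X, smul_add, Finset.sum_add_distrib, add_mul,
    Finset.sum_mul, smul_mul_assoc, pow_zero, Module.End.one_apply]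
  rw [add_right_comm]
  congr 1
  refine Finset.sum_congr rfl fun j _ => ?_
  have h2 : algebraMap ℚ S (((j + 1).factorial : ℚ)⁻¹) * ((j + 1 : ℕ) : S)
      = algebraMap ℚ S ((j.factorial : ℚ)⁻¹) := by
    rw [← map_natCast (algebraMap ℚ S), ← map_mul, Nat.factorial_succ]
    congr 1
    push_cast
    field_simp
  rw [smul_smul, h2, MvPolynomial.smul_eq_C_mul (a := c m), mul_comm (MvPolynomial.C _)]

theorem annihilationExp_C (c : ℕ+ → S) (r : S) :
    annihilationExp c (MvPolynomial.C r) = MvPolynomial.C r := by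
  have h : (annihilationSum c ^ 1) (MvPolynomial.C r) = 0 := by
    change ∑ᶠ n, _ = _
    simp [annihilate]
  rw [annihilationExp, locallyNilpotentExp_apply _ _ _ _ h]
  simp

/-- The algebra homomorphism `a_{-n} ↦ a_{-n} + c_n`. -/
def shiftHom (c : ℕ+ → S) : Fock S →ₐ[S] Fock S :=
  MvPolynomial.aeval fun n => MvPolynomial.X n + MvPolynomial.C (c n)

theorem annihilationExp_apply (c : ℕ+ → S) (v : Fock S) : annihilationExp c v = shiftHom c v := by
  induction v using MvPolynomial.induction_on with
  | C r => rw [annihilationExp_C, shiftHom, MvPolynomial.aeval_C]; rfl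
  | add p q hp hq => rw [map_add, map_add, hp, hq]
  | mul_X p m hp => rw [annihilationExp_mul_X, hp, map_mul]; simp [shiftHom]

end Shift

/-! ### Creation exponentials as multiplication by a series -/

section Creation

variable {S : Type*} [CommRing S] [Algebra ℚ S]

/-- The sequence `n ↦ a_{-n}` of elements of the Fock space, extended by zero. -/
def fockVar (S : Type*) [CommRing S] (n : ℕ) : Fock S :=
  if h : 0 < n then MvPolynomial.X ⟨n, h⟩ else 0

omit [Algebra ℚ S] in
theorem fockVar_coe (n : ℕ+) : fockVar S n = MvPolynomial.X n := dif_pos n.pos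

/-- The series `exp (ε ∑_{n ≥ 1} a_{-n} z ^ n / n)` in the Fock space. -/
def vertexSeries (ε : S) : PowerSeries (Fock S) :=
  expSeries (PowerSeries.C (MvPolynomial.C ε) * logSeries (fockVar S))

theorem algebraMap_rat_fock_mul (q : ℚ) (v : Fock S) :
    algebraMap ℚ (Fock S) q * v = algebraMap ℚ S q • v := by
  rw [MvPolynomial.smul_eq_C_mul]
  rfl

/-- The operators `a_{-n}` lie in the image of the ring map `Algebra.lmul`, so the operator
exponential is the image of a commutative one. -/
theorem coeff_creationExp (ε : S) (r : ℕ) :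
    PowerSeries.coeff r (creationExp ε)
      = LinearMap.mulLeft S (PowerSeries.coeff r (vertexSeries ε)) := by
  have h : (PowerSeries.mk fun n =>
      if h : 0 < n then (ε * algebraMap ℚ S ((n : ℚ)⁻¹)) • create (S := S) ⟨n, h⟩ else 0)
      = PowerSeries.map (Algebra.lmul S (Fock S)).toRingHom
        (PowerSeries.C (MvPolynomial.C ε) * logSeries (fockVar S)) := by
    ext1 n
    rw [PowerSeries.coeff_mk, PowerSeries.coeff_map, PowerSeries.coeff_C_mul, logSeries,
      PowerSeries.coeff_mk, algebraMap_rat_fock_mul, ← MvPolynomial.smul_eq_C_mul, smul_smul,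
      AlgHom.toRingHom_eq_coe, AlgHom.coe_toRingHom, map_smul, fockVar]
    split_ifs with hn
    · rfl
    · rw [map_zero, smul_zero]
  rw [creationExp, h, powerSeriesExp, vertexSeries, expSeries, PowerSeries.coeff_mk,
    PowerSeries.coeff_mk]
  change _ = Algebra.lmul S (Fock S) _
  rw [map_sum]
  refine Finset.sum_congr rfl fun k _ => ?_
  rw [algebraMap_rat_fock_mul, map_smul, ← map_pow, PowerSeries.coeff_map]
  rfl

theorem vertexSeries_neg_mul : vertexSeries (-1 : S) * vertexSeries 1 = 1 := by
  have := expSeries_neg_mul (constantCoeff_logSeries (fockVar S))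
  rw [vertexSeries, vertexSeries, map_neg, map_one, map_neg, map_one, neg_one_mul, one_mul, this]

/-- The coefficients of `vertexSeries 1` are rational polynomials in the variables, so the values of
`φ` on the variables suffice; the translation splits off as a factor by `expSeries_add`. -/
theorem map_vertexSeries {S' : Type*} [CommRing S'] [Algebra ℚ S'] (f : S →+* S')
    (φ : Fock S →+* Fock S') (c : ℕ → S')
    (hφ : ∀ n : ℕ+, φ (MvPolynomial.X n) = MvPolynomial.X n + MvPolynomial.C (c n)) :
    PowerSeries.map φ (vertexSeries (1 : S)) =
      PowerSeries.map (MvPolynomial.map f) (vertexSeries (1 : S)) *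
        PowerSeries.map MvPolynomial.C (expSeries (logSeries c)) := by
  simp only [vertexSeries, map_one, one_mul, map_expSeries]
  rw [← expSeries_add (constantCoeff_map_eq_zero _ (constantCoeff_logSeries _))
    (constantCoeff_map_eq_zero _ (constantCoeff_logSeries _))]
  congr 1
  ext1 n
  simp only [PowerSeries.coeff_map, map_add, logSeries, PowerSeries.coeff_mk, map_mul,
    RingHom.map_rat_algebraMap]
  rcases Nat.eq_zero_or_pos n with rfl | hn
  · simp
  · obtain ⟨m, rfl⟩ : ∃ m : ℕ+, n = m := ⟨⟨n, hn⟩, rfl⟩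
    rw [fockVar_coe, hφ, MvPolynomial.map_X, mul_add]

end Creation

/-! ### Power series coefficients with integer index -/

section IntCoeff

variable {A B : Type*} [CommRing A] [CommRing B]

/-- The coefficients of a power series, extended by zero to negative indices. -/
def intCoeff (f : PowerSeries A) (n : ℤ) : A :=
  if 0 ≤ n then PowerSeries.coeff n.toNat f else 0

theorem intCoeff_natCast (f : PowerSeries A) (n : ℕ) : intCoeff f n = PowerSeries.coeff n f := by
  simp [intCoeff]

theorem intCoeff_of_neg (f : PowerSeries A) {n : ℤ} (h : n < 0) : intCoeff f n = 0 :=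
  if_neg (by omega)

theorem intCoeff_map (φ : A →+* B) (f : PowerSeries A) (n : ℤ) :
    intCoeff (PowerSeries.map φ f) n = φ (intCoeff f n) := by
  unfold intCoeff
  split_ifs <;> simp

theorem intCoeff_add (f g : PowerSeries A) (n : ℤ) :
    intCoeff (f + g) n = intCoeff f n + intCoeff g n := by
  unfold intCoeff
  split_ifs <;> simp

theorem intCoeff_sub (f g : PowerSeries A) (n : ℤ) :
    intCoeff (f - g) n = intCoeff f n - intCoeff g n := by
  unfold intCoeff
  split_ifs <;> simp

theorem intCoeff_C_mul (a : A) (f : PowerSeries A) (n : ℤ) :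
    intCoeff (PowerSeries.C a * f) n = a * intCoeff f n := by
  unfold intCoeff
  split_ifs <;> simp

theorem intCoeff_mul_X (f : PowerSeries A) (n : ℤ) :
    intCoeff (f * PowerSeries.X) n = intCoeff f (n - 1) := by
  rcases lt_or_ge n 1 with h | h
  · rw [intCoeff_of_neg f (by omega)]
    rcases lt_or_ge n 0 with h' | h'
    · rw [intCoeff_of_neg _ h']
    · obtain rfl : n = 0 := by omega
      simp [intCoeff]
  · obtain ⟨m, rfl⟩ : ∃ m : ℕ, n = (m + 1 : ℕ) := ⟨(n - 1).toNat, by omega⟩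
    rw [intCoeff_natCast, PowerSeries.coeff_succ_mul_X, Nat.cast_succ, add_sub_cancel_right,
      intCoeff_natCast]

/-- The quadratic factor `(1 - t z) (1 - t⁻¹ z) = 1 - v z + z ^ 2`, where `v = t + t⁻¹`. -/
def quadSeries (v : A) : PowerSeries A :=
  1 - PowerSeries.C v * PowerSeries.X + PowerSeries.X * PowerSeries.X

theorem intCoeff_mul_quadSeries (f : PowerSeries A) (v : A) (n : ℤ) :
    intCoeff (f * quadSeries v) n
      = intCoeff f n - v * intCoeff f (n - 1) + intCoeff f (n - 2) := by
  have : f * quadSeries v = f - PowerSeries.C v * (f * PowerSeries.X)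
      + f * PowerSeries.X * PowerSeries.X := by
    rw [quadSeries]; ring
  rw [this, intCoeff_add, intCoeff_sub, intCoeff_C_mul, intCoeff_mul_X, intCoeff_mul_X,
    intCoeff_mul_X]
  congr 2
  ring

theorem intCoeff_mul (f g : PowerSeries A) (n : ℤ) :
    intCoeff (f * g) n = ∑ᶠ r : ℕ, PowerSeries.coeff r f * intCoeff g (n - r) := by
  rcases lt_or_ge n 0 with h | h
  · rw [intCoeff_of_neg _ h]
    symm
    apply finsum_eq_zero_of_forall_eq_zero
    intro r
    rw [intCoeff_of_neg g (by omega), mul_zero]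
  · lift n to ℕ using h
    rw [intCoeff_natCast, PowerSeries.coeff_mul,
      Finset.Nat.sum_antidiagonal_eq_sum_range_succ
        (fun i j => PowerSeries.coeff i f * PowerSeries.coeff j g), finsum_eq_sum_of_support_subset]
    · refine Finset.sum_congr rfl fun r hr => ?_
      have : ((n : ℤ) - r) = ((n - r : ℕ) : ℤ) := by
        have := Finset.mem_range.1 hr
        omega
      rw [this, intCoeff_natCast]
    · intro r hr
      by_contra hlt
      simp only [Finset.coe_range, Set.mem_Iio, not_lt] at hlt
      exact hr (by simp only []; rw [intCoeff_of_neg g (by omega), mul_zero])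

end IntCoeff

/-! ### Modes in `z` and the double shift -/

section Modes

open LaurentPolynomial

variable {R : Type*} [CommRing R]

theorem coeff_zCoeff (k : ℤ) (u : Fock R[T;T⁻¹]) (d : ℕ+ →₀ ℕ) :
    MvPolynomial.coeff d (zCoeff k u) = (MvPolynomial.coeff d u).coeff k :=
  rfl

theorem zCoeff_map_C_mul (k : ℤ) (f : Fock R) (u : Fock R[T;T⁻¹]) :
    zCoeff k (MvPolynomial.map LaurentPolynomial.C f * u) = f * zCoeff k u := by
  classical
  ext d
  rw [coeff_zCoeff, MvPolynomial.coeff_mul, MvPolynomial.coeff_mul, AddMonoidAlgebra.coeff_sum,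
    Finsupp.finsetSum_apply]
  refine Finset.sum_congr rfl fun p _ => ?_
  rw [MvPolynomial.coeff_map, ← LaurentPolynomial.smul_eq_C_mul, coeff_zCoeff]
  rfl

theorem zCoeff_C_T_mul (k m : ℤ) (u : Fock R[T;T⁻¹]) :
    zCoeff k (MvPolynomial.C (T m) * u) = zCoeff (k - m) u := by
  ext d
  rw [coeff_zCoeff, coeff_zCoeff, MvPolynomial.coeff_C_mul, T]
  rw [AddMonoidAlgebra.coeff_single_mul_eq_mul_coeff (k - m) (fun j _ => by omega), one_mul]

theorem zCoeff_map_C (k : ℤ) (f : Fock R) :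
    zCoeff k (MvPolynomial.map LaurentPolynomial.C f) = if k = 0 then f else 0 := by
  ext d
  rw [coeff_zCoeff, MvPolynomial.coeff_map, LaurentPolynomial.C_apply]
  split_ifs <;> simp

theorem finite_support_vertexMode (Q : PowerSeries (Fock R)) (k : ℤ) (u : Fock R[T;T⁻¹]) :
    (Function.support fun r : ℕ =>
      (LinearMap.mulLeft R (PowerSeries.coeff r Q) ∘ₗ zCoeff (k - r)) u).Finite := by
  have hinj : Set.InjOn (fun r : ℕ => k - (r : ℤ))
      ((fun r : ℕ => k - (r : ℤ)) ⁻¹' Function.support fun j : ℤ => zCoeff j u) :=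
    fun a _ b _ h => by simpa using h
  refine ((finite_support_zCoeff u).preimage hinj).subset fun r hr h0 => hr ?_
  have h0' : zCoeff (k - (r : ℤ)) u = 0 := h0
  simp only [LinearMap.comp_apply, h0', map_zero]

/-- The coefficient of `z ^ k` in `Q(z) u(z)`. -/
def vertexMode (Q : PowerSeries (Fock R)) (k : ℤ) : Fock R[T;T⁻¹] →ₗ[R] Fock R :=
  locallyFiniteSum (fun r : ℕ => LinearMap.mulLeft R (PowerSeries.coeff r Q) ∘ₗ zCoeff (k - r))
    (finite_support_vertexMode Q k)

theorem vertexMode_apply (Q : PowerSeries (Fock R)) (k : ℤ) (u : Fock R[T;T⁻¹]) :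
    vertexMode Q k u = ∑ᶠ r : ℕ, PowerSeries.coeff r Q * zCoeff (k - r) u :=
  rfl

/-- Factors free of `z` pass through a mode. This semilinearity is what lets a mode act on a single
row or column of a determinant. -/
theorem vertexMode_map_C_mul (Q : PowerSeries (Fock R)) (k : ℤ) (f : Fock R)
    (u : Fock R[T;T⁻¹]) :
    vertexMode Q k (MvPolynomial.map LaurentPolynomial.C f * u) = f * vertexMode Q k u := by
  have h : (Function.support fun r : ℕ => PowerSeries.coeff r Q * zCoeff (k - r) u).Finite :=
    finite_support_vertexMode Q k u
  rw [vertexMode_apply, vertexMode_apply, mul_finsum' _ _ h]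
  refine finsum_congr fun r => ?_
  rw [zCoeff_map_C_mul]
  exact mul_left_comm _ _ _

theorem vertexMode_C_T (Q : PowerSeries (Fock R)) (k m : ℤ) :
    vertexMode Q k (MvPolynomial.C (T m)) = intCoeff Q (k - m) := by
  have h : ∀ r : ℕ, zCoeff (k - r) (MvPolynomial.C (T m))
      = if k - r - m = 0 then (1 : Fock R) else 0 := by
    intro r
    have := zCoeff_C_T_mul (k - r) m (MvPolynomial.map LaurentPolynomial.C (1 : Fock R))
    rwa [map_one, mul_one, ← map_one (MvPolynomial.map LaurentPolynomial.C), zCoeff_map_C] at this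
  simp only [vertexMode_apply, h]
  rcases lt_or_ge (k - m) 0 with hn | hn
  · rw [intCoeff_of_neg _ hn]
    apply finsum_eq_zero_of_forall_eq_zero
    intro r
    rw [if_neg (by omega), mul_zero]
  · rw [intCoeff, if_pos hn, finsum_eq_single _ (k - m).toNat, if_pos (by omega), mul_one]
    intro r hr
    rw [if_neg (by omega), mul_zero]

variable [Algebra ℚ R]

/-- The substitution `a_{-n} ↦ a_{-n} + ε (z ^ n + z ^ (-n))`. -/
def doubleShift (ε : R) : Fock R →+* Fock R[T;T⁻¹] :=
  (shiftHom fun n : ℕ+ => LaurentPolynomial.C ε * (T (-((n : ℕ) : ℤ)) + T ((n : ℕ) : ℤ))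
    ).toRingHom.comp (MvPolynomial.map LaurentPolynomial.C)

theorem annihilationHalf_apply (p : R[T;T⁻¹]) (ε : R) (v : Fock R) :
    annihilationHalf p ε v = MvPolynomial.C p * doubleShift ε v := by
  rw [← MvPolynomial.smul_eq_C_mul]
  change p • annihilationExp _ (MvPolynomial.map LaurentPolynomial.C v) = _
  rw [annihilationExp_apply]
  rfl

theorem productCoeff_creationExp (ε δ : R) (p : R[T;T⁻¹]) (k : ℤ) (v : Fock R) :
    productCoeff (creationExp ε) (annihilationHalf p δ) k v
      = vertexMode (vertexSeries ε) k (MvPolynomial.C p * doubleShift δ v) := by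
  change ∑ᶠ r : ℕ, _ = ∑ᶠ r : ℕ, _
  refine finsum_congr fun r => ?_
  simp only [coeff_creationExp, ← annihilationHalf_apply, LinearMap.comp_apply]

omit [Algebra ℚ R] in
theorem doubleShift_C (ε r : R) : doubleShift ε (MvPolynomial.C r)
    = MvPolynomial.C (LaurentPolynomial.C r) := by
  change shiftHom _ (MvPolynomial.map _ (MvPolynomial.C r)) = _
  rw [MvPolynomial.map_C, shiftHom, MvPolynomial.aeval_C]
  rfl

omit [Algebra ℚ R] in
theorem doubleShift_X (ε : R) (n : ℕ+) : doubleShift ε (MvPolynomial.X n)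
    = MvPolynomial.X n + MvPolynomial.C (LaurentPolynomial.C ε *
      (T (-((n : ℕ) : ℤ)) + T ((n : ℕ) : ℤ))) := by
  change shiftHom _ (MvPolynomial.map _ (MvPolynomial.X n)) = _
  rw [MvPolynomial.map_X, shiftHom, MvPolynomial.aeval_X]

/-- The element `z + z⁻¹` of the Fock space over the Laurent polynomials. -/
def zTrace (R : Type*) [CommRing R] : Fock R[T;T⁻¹] := MvPolynomial.C (T 1 + T (-1))

theorem expSeries_logSeries_trace :
    expSeries (logSeries fun n : ℕ => (T (-(n : ℤ)) + T (n : ℤ) : R[T;T⁻¹]))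
      * quadSeries (T 1 + T (-1)) = 1 := by
  have h : (logSeries fun n : ℕ => (T (-(n : ℤ)) + T (n : ℤ) : R[T;T⁻¹]))
      = (logSeries fun n : ℕ => (T (-1) : R[T;T⁻¹]) ^ n)
        + logSeries fun n : ℕ => (T 1 : R[T;T⁻¹]) ^ n := by
    ext1 n
    simp only [logSeries, PowerSeries.coeff_mk, map_add, T_pow, mul_add, mul_neg, mul_one]
  have hT : (T 1 * T (-1) : R[T;T⁻¹]) = 1 := by rw [← T_add]; simp
  have hq : quadSeries (T 1 + T (-1) : R[T;T⁻¹])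
      = (1 - PowerSeries.C (T (-1)) * PowerSeries.X) *
        (1 - PowerSeries.C (T 1) * PowerSeries.X) := by
    have hC : (PowerSeries.C (T 1) * PowerSeries.C (T (-1)) : PowerSeries R[T;T⁻¹]) = 1 := by
      rw [← map_mul, hT, map_one]
    rw [quadSeries, map_add]
    linear_combination -(PowerSeries.X * PowerSeries.X) * hC
  rw [h, expSeries_add (constantCoeff_logSeries _) (constantCoeff_logSeries _), hq,
    mul_mul_mul_comm, expSeries_logSeries_pow, expSeries_logSeries_pow, one_mul]

theorem map_quadSeries {A B : Type*} [CommRing A] [CommRing B] (φ : A →+* B) (v : A) :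
    PowerSeries.map φ (quadSeries v) = quadSeries (φ v) := by
  simp [quadSeries]

/-- With `q(w) = (1 - zw)(1 - w/z)`, the translation by `z^n + z^(-n)` multiplies `H(w)` by
`exp(-log q(w)) = 1/q(w)`. -/
theorem map_doubleShift_one_vertexSeries :
    PowerSeries.map (doubleShift (1 : R)) (vertexSeries 1) * quadSeries (zTrace R)
      = PowerSeries.map (MvPolynomial.map LaurentPolynomial.C) (vertexSeries 1) := by
  rw [map_vertexSeries LaurentPolynomial.C (doubleShift (1 : R))
    (fun n => T (-(n : ℤ)) + T (n : ℤ)) (fun n => by rw [doubleShift_X, map_one, one_mul]),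
    zTrace, ← map_quadSeries, mul_assoc, ← map_mul, expSeries_logSeries_trace, map_one, mul_one]

theorem map_doubleShift_neg_one_vertexSeries :
    PowerSeries.map (doubleShift (-1 : R)) (vertexSeries 1)
      = PowerSeries.map (MvPolynomial.map LaurentPolynomial.C) (vertexSeries 1)
        * quadSeries (zTrace R) := by
  have h : (logSeries fun n : ℕ => -(T (-(n : ℤ)) + T (n : ℤ) : R[T;T⁻¹]))
      = -(logSeries fun n : ℕ => (T (-(n : ℤ)) + T (n : ℤ) : R[T;T⁻¹])) := by
    ext1 n
    simp only [logSeries, PowerSeries.coeff_mk, map_neg, mul_neg]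
  rw [map_vertexSeries LaurentPolynomial.C (doubleShift (-1 : R))
    (fun n => -(T (-(n : ℤ)) + T (n : ℤ)))
    (fun n => by rw [doubleShift_X, map_neg, map_one, neg_one_mul]),
    zTrace, ← map_quadSeries, h]
  congr 2
  have h1 := expSeries_neg_mul (constantCoeff_logSeries
    (A := R[T;T⁻¹]) fun n : ℕ => T (-(n : ℤ)) + T (n : ℤ))
  -- Uniqueness of inverses: `quadSeries` and the exponential of the negated series are both inverse
  -- to the same exponential.
  linear_combination quadSeries (T 1 + T (-1)) * h1
    - expSeries (-logSeries fun n : ℕ => (T (-(n : ℤ)) + T (n : ℤ) : R[T;T⁻¹]))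
      * expSeries_logSeries_trace (R := R)

end Modes

/-! ### The action of `Γ₊` on the generating series -/

section Gamma

variable {S : Type*} [CommRing S] [Algebra ℚ S]

theorem exists_algHom_Gamma (y : S) : ∃ φ : Fock S →ₐ[S] Fock S, (∀ v, Gamma y v = φ v) ∧
    PowerSeries.map φ.toRingHom (vertexSeries 1) *
      PowerSeries.map MvPolynomial.C (1 - PowerSeries.C y * PowerSeries.X) = vertexSeries 1 := by
  refine ⟨shiftHom fun n => y ^ (n : ℕ), annihilationExp_apply _, ?_⟩
  rw [map_vertexSeries (RingHom.id S) _ (fun n => y ^ n)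
    (fun n => by simp [shiftHom]), mul_assoc, ← map_mul, expSeries_logSeries_pow, map_one, mul_one]
  ext1 n
  rw [PowerSeries.coeff_map, MvPolynomial.map_id]

/-- The relation `φ(H) Q = H`, written without inverses, is stable under composition because algebra
maps fix the scalar series `Q₂`. -/
theorem exists_algHom_mul {T₁ T₂ : Module.End S (Fock S)} {Q₁ Q₂ : PowerSeries S}
    (h₁ : ∃ φ : Fock S →ₐ[S] Fock S, (∀ v, T₁ v = φ v) ∧
      PowerSeries.map φ.toRingHom (vertexSeries 1) * PowerSeries.map MvPolynomial.C Q₁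
        = vertexSeries 1)
    (h₂ : ∃ φ : Fock S →ₐ[S] Fock S, (∀ v, T₂ v = φ v) ∧
      PowerSeries.map φ.toRingHom (vertexSeries 1) * PowerSeries.map MvPolynomial.C Q₂
        = vertexSeries 1) :
    ∃ φ : Fock S →ₐ[S] Fock S, (∀ v, (T₁ * T₂) v = φ v) ∧
      PowerSeries.map φ.toRingHom (vertexSeries 1) * PowerSeries.map MvPolynomial.C (Q₁ * Q₂)
        = vertexSeries 1 := by
  obtain ⟨φ₁, e₁, h₁⟩ := h₁
  obtain ⟨φ₂, e₂, h₂⟩ := h₂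
  refine ⟨φ₁.comp φ₂, fun v => by rw [Module.End.mul_apply, e₂, e₁]; rfl, ?_⟩
  have hC : PowerSeries.map φ₁.toRingHom (PowerSeries.map MvPolynomial.C Q₂)
      = PowerSeries.map MvPolynomial.C Q₂ := by
    ext1 n
    simp only [PowerSeries.coeff_map]
    exact φ₁.commutes _
  have h := congrArg (PowerSeries.map φ₁.toRingHom) h₂
  rw [map_mul, hC] at h
  have hcomp : PowerSeries.map (φ₁.comp φ₂).toRingHom (vertexSeries (1 : S))
      = PowerSeries.map φ₁.toRingHom (PowerSeries.map φ₂.toRingHom (vertexSeries 1)) := by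
    ext1 n
    simp only [PowerSeries.coeff_map]
    rfl
  rw [hcomp, map_mul]
  linear_combination PowerSeries.map MvPolynomial.C Q₁ * h + h₁

theorem exists_algHom_GammaPM {N : ℕ} (x : Fin N → Sˣ) :
    ∃ φ : Fock S →ₐ[S] Fock S, (∀ v, GammaPM x v = φ v) ∧
      PowerSeries.map φ.toRingHom (vertexSeries 1) * PowerSeries.map MvPolynomial.C
        (∏ i, (1 - PowerSeries.C ((x i : Sˣ) : S) * PowerSeries.X) *
        (1 - PowerSeries.C (((x i)⁻¹ : Sˣ) : S) * PowerSeries.X)) = vertexSeries 1 := by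
  induction N with
  | zero =>
    refine ⟨AlgHom.id S _, fun v => by simp [GammaPM], ?_⟩
    ext1 n
    simp
  | succ N ih =>
    rw [Fin.prod_univ_succ]
    have : GammaPM x = Gamma ((x 0 : Sˣ) : S) * Gamma (((x 0)⁻¹ : Sˣ) : S)
        * GammaPM fun i => x i.succ := by
      simp [GammaPM, List.ofFn_succ]
    rw [this]
    exact exists_algHom_mul (exists_algHom_mul (exists_algHom_Gamma _) (exists_algHom_Gamma _))
      (ih _)

end Gamma

/-! ### Column operations and maps acting on one column -/

section Determinants

variable {A B : Type*} [CommRing A] [CommRing B]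

/-- Column operations `col_j ↦ col_j - v col_{j-1} + col_{j-2}` for `j > l`, where only columns of
index at least `l` are used, do not change a determinant. -/
theorem det_three_term_columns {n : ℕ} (l : ℕ) (v : A) (a b : Fin n → ℕ → A)
    (h₁ : ∀ i j, j ≤ l → b i j = a i j)
    (h₂ : ∀ i j, l < j →
      b i j = a i j - v * a i (j - 1) + if l + 2 ≤ j then a i (j - 2) else 0) :
    Matrix.det (Matrix.of fun i j : Fin n => b i j)
      = Matrix.det (Matrix.of fun i j : Fin n => a i j) := by
  -- The column operations are right multiplication by this unitriangular matrix, of determinant 1.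
  set U : Matrix (Fin n) (Fin n) A := Matrix.of fun k j =>
    (if k = j then 1 else 0) + (if l < (j : ℕ) then (if (k : ℕ) + 1 = j then -v else 0)
      + (if l + 2 ≤ (j : ℕ) then (if (k : ℕ) + 2 = j then 1 else 0) else 0) else 0) with hU
  have hsum : ∀ (i j : Fin n) (d : ℕ) (c : A), d ≤ (j : ℕ) →
      ∑ k : Fin n, a i k * (if (k : ℕ) + d = j then c else 0) = a i (j - d) * c := by
    intro i j d c hd
    rw [Finset.sum_eq_single (⟨j - d, by omega⟩ : Fin n)]
    · rw [if_pos (by simp only []; omega)]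
    · intro k _ hk
      rw [if_neg, mul_zero]
      intro h
      exact hk (Fin.ext (by simp only []; omega))
    · simp
  have hmul : (Matrix.of fun i j : Fin n => b i j) = (Matrix.of fun i j : Fin n => a i j) * U := by
    ext i j
    rw [Matrix.mul_apply]
    simp only [hU, Matrix.of_apply, mul_add, Finset.sum_add_distrib]
    rw [Finset.sum_eq_single j (fun k _ hk => by rw [if_neg hk, mul_zero]) (by simp), if_pos rfl,
      mul_one]
    rcases Nat.lt_or_ge l j with hj | hj
    · simp only [if_pos hj, mul_add, Finset.sum_add_distrib]
      rw [hsum i j 1 _ (by omega), h₂ i j hj]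
      split_ifs with h
      · rw [hsum i j 2 _ (by omega)]
        ring
      · simp only [mul_zero, Finset.sum_const_zero]
        ring
    · rw [h₁ i j hj]
      simp [not_lt.2 hj]
  have hdet : U.det = 1 := by
    rw [Matrix.det_of_isUpperTriangular]
    · refine Finset.prod_eq_one fun k _ => ?_
      simp [hU]
    · intro k j hkj
      have hkj' : (j : ℕ) < k := hkj
      have h0 : k ≠ j := fun h => by omega
      have h1 : (k : ℕ) + 1 ≠ j := by omega
      have h2 : (k : ℕ) + 2 ≠ j := by omega
      simp [hU, h0, h1, h2]
  rw [hmul, Matrix.det_mul, hdet, mul_one]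

/-- Laplace expansion along column `c`, by cofactors of a matrix with the same other columns. -/
theorem det_eq_sum_adjugate {n : ℕ} (Z Z' : Matrix (Fin n) (Fin n) A) (c : Fin n)
    (hZ : ∀ i j, j ≠ c → Z i j = Z' i j) : Z.det = ∑ i, Z'.adjugate c i * Z i c := by
  have e : Z = Z'.updateCol c fun i => Z i c := by
    ext i j
    by_cases hj : j = c
    · subst hj
      rw [Matrix.updateCol_self]
    · rw [Matrix.updateCol_ne hj, hZ i j hj]
  conv_lhs => rw [e]
  rw [← Matrix.cramer_apply, Matrix.cramer_eq_adjugate_mulVec]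
  rfl

/-- A semilinear map applied to a determinant acts on the only column that is not defined over
the smaller ring. -/
theorem map_det_of_column {n : ℕ} (ι : A →+* B) (Φ : B →+ A) (hΦ : ∀ a b, Φ (ι a * b) = a * Φ b)
    (c : Fin n) (X : Matrix (Fin n) (Fin n) B) (Y : Matrix (Fin n) (Fin n) A)
    (hX : ∀ i j, j ≠ c → X i j = ι (Y i j)) (hY : ∀ i, Y i c = Φ (X i c)) :
    Φ X.det = Y.det := by
  rw [det_eq_sum_adjugate X (ι.mapMatrix Y) c hX, det_eq_sum_adjugate Y Y c fun _ _ _ => rfl,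
    map_sum]
  refine Finset.sum_congr rfl fun i _ => ?_
  rw [← RingHom.map_adjugate, RingHom.mapMatrix_apply, Matrix.map_apply, hΦ, hY]

theorem map_det_of_row {n : ℕ} (ι : A →+* B) (Φ : B →+ A) (hΦ : ∀ a b, Φ (ι a * b) = a * Φ b)
    (c : Fin n) (X : Matrix (Fin n) (Fin n) B) (Y : Matrix (Fin n) (Fin n) A)
    (hX : ∀ i j, i ≠ c → X i j = ι (Y i j)) (hY : ∀ j, Y c j = Φ (X c j)) :
    Φ X.det = Y.det := by
  rw [← Matrix.det_transpose, ← Matrix.det_transpose Y]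
  exact map_det_of_column ι Φ hΦ c X.transpose Y.transpose (fun i j hj => hX j i hj) hY

end Determinants

/-! ### Determinant formula for the ket -/

section Ket

open LaurentPolynomial

variable {R : Type*} [CommRing R] [Algebra ℚ R]

/-- The determinant `det (f_{p_i + j} - f_{p_i - j})`, `1 ≤ j ≤ n`. -/
def orthogonalDet {A : Type*} [CommRing A] {n : ℕ} (f : ℤ → A) (p : Fin n → ℤ) : A :=
  Matrix.det (Matrix.of fun i j : Fin n =>
    f (p i + ((j : ℕ) + 1 : ℤ)) - f (p i - ((j : ℕ) + 1 : ℤ)))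

theorem doubleShift_neg_one_intCoeff (r : ℤ) :
    doubleShift (-1 : R) (intCoeff (vertexSeries 1) r)
      = MvPolynomial.map LaurentPolynomial.C (intCoeff (vertexSeries 1) r)
        - zTrace R * MvPolynomial.map LaurentPolynomial.C (intCoeff (vertexSeries 1) (r - 1))
        + MvPolynomial.map LaurentPolynomial.C (intCoeff (vertexSeries 1) (r - 2)) := by
  rw [← intCoeff_map, map_doubleShift_neg_one_vertexSeries, intCoeff_mul_quadSeries, intCoeff_map,
    intCoeff_map, intCoeff_map]

/-- The shift turns every entry into a three-term combination. Bordering the matrix by the first row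
`(1 - z², 0, …, 0)` allows these to be undone by column operations, after which only the first row
involves `z`. -/
theorem W_apply_orthogonalDet {n : ℕ} (k : ℤ) (p : Fin n → ℤ) :
    W (R := R) (-k) (orthogonalDet (intCoeff (vertexSeries 1)) p)
      = orthogonalDet (intCoeff (vertexSeries 1))
        (Fin.cons (k - 1) (fun i => p i - 1) : Fin (n + 1) → ℤ) := by
  set H : ℤ → Fock R := intCoeff (vertexSeries 1) with hH
  set ι : Fock R →+* Fock R[T;T⁻¹] := MvPolynomial.map LaurentPolynomial.C
  set v := zTrace R with hv
  rw [W, productCoeff_creationExp, neg_neg]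
  -- The first row `c_j = z^(-j) - z^(j+2)` solves `c_j = (z + z⁻¹) c_{j-1} - c_{j-2}` with `c_{-1}
  -- = 0` and `c_0 = 1 - z²`, so the column operations reduce it to `(1 - z², 0, …, 0)`.
  let a : Fin (n + 1) → ℕ → Fock R[T;T⁻¹] := Fin.cons
    (fun j => MvPolynomial.C (T (-(j : ℤ)) - T ((j : ℤ) + 2)))
    (fun i j => ι (H (p i - 1 + ((j : ℤ) + 1)) - H (p i - 1 - ((j : ℤ) + 1))))
  let b : Fin (n + 1) → ℕ → Fock R[T;T⁻¹] := fun i j =>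
    if j = 0 then a i 0 else a i j - v * a i (j - 1) + if 2 ≤ j then a i (j - 2) else 0
  have hdet := det_three_term_columns 0 v a b
    (fun i j hj => by rw [Nat.le_zero.1 hj]; rfl)
    (fun i j hj => by simp only [b]; rw [if_neg (by omega)])
  have hb0 : ∀ j, b 0 (j + 1) = 0 := by
    intro j
    have hT : ∀ x y : ℤ, (MvPolynomial.C (T x) * MvPolynomial.C (T y) : Fock R[T;T⁻¹])
        = MvPolynomial.C (T (x + y)) := fun x y => by rw [← map_mul, T_add]
    simp only [b, a, Fin.cons_zero, Nat.add_sub_cancel, if_neg (Nat.succ_ne_zero j), hv, zTrace,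
      map_add, map_sub, add_mul, mul_sub, hT]
    rcases Nat.eq_zero_or_pos j with rfl | hj
    · norm_num
    · rw [if_pos (by omega)]
      have e1 : ((j + 1 - 2 : ℕ) : ℤ) = j - 1 := by omega
      rw [e1]
      push_cast
      ring_nf
  have hbs : ∀ i j, b (Fin.succ i) (j + 1)
      = doubleShift (-1 : R) (H (p i + ((j : ℤ) + 1)) - H (p i - ((j : ℤ) + 1))) := by
    intro i j
    rw [map_sub, hH, doubleShift_neg_one_intCoeff, doubleShift_neg_one_intCoeff, ← hH]
    simp only [b, a, Fin.cons_succ, Nat.add_sub_cancel, if_neg (Nat.succ_ne_zero j), map_sub]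
    have e2 : p i - 1 + (((j + 1 : ℕ) : ℤ) + 1) = p i + (j + 1) := by push_cast; ring
    have e3 : p i - 1 - (((j + 1 : ℕ) : ℤ) + 1) = p i - (j + 1) - 2 := by push_cast; ring
    have e4 : p i - 1 + ((j : ℤ) + 1) = p i + (j + 1) - 1 := by ring
    have e5 : p i - 1 - ((j : ℤ) + 1) = p i - (j + 1) - 1 := by ring
    rw [e2, e3, e4, e5]
    -- For `j = 0` the missing third column would have entries `H(p i - 1) - H(p i - 1) = 0`, so the
    -- three-term rule persists at the boundary.
    rcases Nat.eq_zero_or_pos j with rfl | hj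
    · have e6 : p i + (((0 : ℕ) : ℤ) + 1) - 2 = p i - (((0 : ℕ) : ℤ) + 1) := by push_cast; ring
      rw [if_neg (by omega), e6]
      ring
    · have e1 : ((j + 1 - 2 : ℕ) : ℤ) = j - 1 := by omega
      have e6 : p i - 1 + ((j : ℤ) - 1 + 1) = p i + (j + 1) - 2 := by ring
      have e7 : p i - 1 - ((j : ℤ) - 1 + 1) = p i - (j + 1) := by ring
      rw [if_pos (by omega), e1, e6, e7]
      ring
  have hb : MvPolynomial.C (1 - T 2) * doubleShift (-1 : R) (orthogonalDet H p)
      = Matrix.det (Matrix.of fun i j : Fin (n + 1) => b i j) := by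
    rw [Matrix.det_succ_row_zero, Finset.sum_eq_single 0]
    · rw [orthogonalDet, RingHom.map_det]
      have : b 0 0 = MvPolynomial.C (1 - T 2) := by
        simp [b, a]
      simp only [Fin.val_zero, pow_zero, one_mul, Matrix.of_apply, this]
      congr 2
      ext1 i j
      simp only [RingHom.mapMatrix_apply, Matrix.map_apply, Matrix.of_apply, Matrix.submatrix_apply,
        Fin.zero_succAbove, Fin.val_succ]
      exact (hbs i j).symm
    · intro j _ hj
      obtain ⟨j, rfl⟩ := Fin.exists_succ_eq.2 hj
      simp only [Matrix.of_apply, Fin.val_succ, hb0, mul_zero, zero_mul]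
    · simp
  rw [hb, hdet]
  refine map_det_of_row ι (vertexMode (vertexSeries 1) k).toAddMonoidHom
    (vertexMode_map_C_mul _ _) 0 _ _ ?_ ?_
  · intro i j hi
    obtain ⟨i, rfl⟩ := Fin.exists_succ_eq.2 hi
    simp only [a, Matrix.of_apply, Fin.cons_succ]
  -- The coefficient of `z^k` in `H(z)(z^(-j) - z^(j+2))` is `H_{k+j} - H_{k-j-2}`, a row of the
  -- same shape with `p = k - 1`.
  · intro j
    simp only [a, Matrix.of_apply, Fin.cons_zero, map_sub, LinearMap.toAddMonoidHom_coe,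
      vertexMode_C_T, ← hH]
    congr 2 <;> ring

/-- Each new row on top starts at `k - 1` and lowers the offsets below it by 1, which accumulates to
`λ_i - i`. -/
theorem ketO_eq_orthogonalDet {n : ℕ} (lam : Fin n → ℕ) :
    ketO (R := R) lam = orthogonalDet (intCoeff (vertexSeries 1))
      fun i => (lam i : ℤ) - ((i : ℕ) + 1 : ℤ) := by
  induction n with
  | zero => simp [ketO, orthogonalDet]
  | succ n ih =>
    have h := ih fun i => lam i.succ
    rw [ketO] at h ⊢
    rw [List.ofFn_succ, List.prod_cons, Module.End.mul_apply, h, W_apply_orthogonalDet]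
    congr 1
    funext i
    refine Fin.cases ?_ (fun i => ?_) i
    · simp
    · simp only [Fin.cons_succ, Fin.val_succ]
      push_cast
      ring

end Ket

/-! ### The bra and the skew determinant -/

section Skew

open LaurentPolynomial

variable {R : Type*} [CommRing R] [Algebra ℚ R]

/-- The determinant of the matrix whose first `l` columns are `g_{p_i + j - μ_j}` and whose other
columns are `f_{p_i + j} - f_{p_i - j + 2 l}`, `1 ≤ j ≤ n`. -/
def mixedDet {A : Type*} [CommRing A] {n : ℕ} (g f : ℤ → A) (mu : ℕ → ℕ) (p : Fin n → ℤ)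
    (l : ℕ) : A :=
  Matrix.det (Matrix.of fun i j : Fin n =>
    if (j : ℕ) < l then g (p i + ((j : ℕ) + 1 : ℤ) - mu j)
    else f (p i + ((j : ℕ) + 1 : ℤ)) - f (p i - ((j : ℕ) + 1 : ℤ) + 2 * l))

section Bra

variable {F : PowerSeries (Fock R)} {g : PowerSeries R}
  (hF : F = vertexSeries 1 * PowerSeries.map MvPolynomial.C g)

include hF

theorem doubleShift_one_intCoeff (r : ℤ) :
    doubleShift (1 : R) (intCoeff F r) - zTrace R * doubleShift (1 : R) (intCoeff F (r - 1))
        + doubleShift (1 : R) (intCoeff F (r - 2))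
      = MvPolynomial.map LaurentPolynomial.C (intCoeff F r) := by
  have hC : PowerSeries.map (doubleShift (1 : R)) (PowerSeries.map MvPolynomial.C g)
      = PowerSeries.map (MvPolynomial.map LaurentPolynomial.C)
        (PowerSeries.map MvPolynomial.C g) := by
    ext1 n
    simp only [PowerSeries.coeff_map, doubleShift_C, MvPolynomial.map_C]
  rw [← intCoeff_map, ← intCoeff_map, ← intCoeff_map, ← intCoeff_map, ← intCoeff_mul_quadSeries]
  congr 1
  rw [hF, map_mul, map_mul, hC, ← map_doubleShift_one_vertexSeries]
  ring

/-- This is `(1 - w²)/((1 - zw)(1 - w/z)) = ∑_k z^k w^|k|` multiplied by `F(w)`, read off at `z^k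
w^q`. -/
theorem zCoeff_doubleShift_one_sub (q k : ℤ) :
    zCoeff k (doubleShift (1 : R) (intCoeff F q) - doubleShift (1 : R) (intCoeff F (q - 2)))
      = intCoeff F (q - |k|) := by
  obtain ⟨e, he⟩ : ∃ e : ℤ → Fock R[T;T⁻¹], e = fun q =>
    doubleShift (1 : R) (intCoeff F q) - doubleShift (1 : R) (intCoeff F (q - 2)) := ⟨_, rfl⟩
  have hneg : ∀ q < 0, e q = 0 := fun q hq => by
    simp only [he]
    rw [intCoeff_of_neg _ hq, intCoeff_of_neg _ (by omega), sub_self]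
  have hrec : ∀ q, e q = MvPolynomial.C (T 1) * e (q - 1) + MvPolynomial.C (T (-1)) * e (q - 1)
      - e (q - 2) + (MvPolynomial.map LaurentPolynomial.C (intCoeff F q)
        - MvPolynomial.map LaurentPolynomial.C (intCoeff F (q - 2))) := by
    intro q
    simp only [he]
    rw [← doubleShift_one_intCoeff hF q, ← doubleShift_one_intCoeff hF (q - 2), zTrace, map_add,
      sub_right_comm q 1 2]
    ring
  -- The recurrence expresses `e q` through `e (q - 1)` and `e (q - 2)`, so the induction is on an
  -- upper bound for `q`; for `q < 0` both sides vanish.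
  have key : ∀ (m : ℕ) (q k : ℤ), q < m → zCoeff k (e q) = intCoeff F (q - |k|) := by
    intro m
    induction m with
    | zero =>
      intro q k hq
      rw [hneg q (by simpa using hq), map_zero, intCoeff_of_neg]
      have := abs_nonneg k
      push_cast at hq
      omega
    | succ m ih =>
      intro q k hq
      push_cast at hq
      rw [hrec, map_add, map_sub, map_sub, map_add, zCoeff_C_T_mul, zCoeff_C_T_mul,
        ih _ _ (by omega), ih _ _ (by omega), ih _ _ (by omega), zCoeff_map_C, zCoeff_map_C]
      rcases lt_trichotomy k 0 with hk | rfl | hk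
      · rw [if_neg hk.ne, if_neg hk.ne, abs_of_neg hk, abs_of_neg (by omega : k - 1 < 0),
          abs_of_nonpos (by omega : k - -1 ≤ 0)]
        ring_nf
      · norm_num
        ring_nf
      · rw [if_neg hk.ne', if_neg hk.ne', abs_of_pos hk, abs_of_nonneg (by omega : 0 ≤ k - 1),
          abs_of_nonneg (by omega : 0 ≤ k - -1)]
        ring_nf
  have := key (q.toNat + 1) q k (by omega)
  rwa [he] at this

/-- Since `m ≥ 0`, the exponents `-m - r` are all nonpositive and the absolute value opens to `m +
r`. The mode becomes an ordinary Cauchy product, namely a coefficient of `H⁻¹F = g`. -/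
theorem vertexMode_doubleShift_one_sub (q : ℤ) (m : ℕ) :
    vertexMode (vertexSeries (-1)) (-(m : ℤ))
        (doubleShift (1 : R) (intCoeff F q) - doubleShift (1 : R) (intCoeff F (q - 2)))
      = MvPolynomial.C (intCoeff g (q - m)) := by
  have h : vertexSeries (-1) * F = PowerSeries.map MvPolynomial.C g := by
    rw [hF, ← mul_assoc, vertexSeries_neg_mul, one_mul]
  rw [← intCoeff_map MvPolynomial.C, ← h, intCoeff_mul, vertexMode_apply]
  refine finsum_congr fun r => ?_
  rw [zCoeff_doubleShift_one_sub hF, abs_of_nonpos (by omega)]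
  congr 2
  ring

/-- Column operations to the right of column `l` multiply the shifted `F` by `q` and so remove `z`.
In the reflected term the index grows as the column index falls, so the combination is centred two
places higher, and `2l` becomes `2(l + 1)`. Column `l` has no earlier `F`-column to combine with and
alone keeps `z`. -/
theorem doubleShift_one_mixedDet {n : ℕ} (mu : ℕ → ℕ) (p : Fin n → ℤ) (l : ℕ) :
    doubleShift (1 : R)
        (mixedDet (fun k => MvPolynomial.C (intCoeff g k)) (intCoeff F) mu p l)
      = Matrix.det (Matrix.of fun i j : Fin n =>
        if (j : ℕ) = l then doubleShift (1 : R) (intCoeff F (p i + ((l : ℤ) + 1)))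
          - doubleShift (1 : R) (intCoeff F (p i + ((l : ℤ) + 1) - 2))
        else MvPolynomial.map LaurentPolynomial.C
          (if (j : ℕ) < l + 1 then MvPolynomial.C (intCoeff g (p i + ((j : ℕ) + 1 : ℤ) - mu j))
          else intCoeff F (p i + ((j : ℕ) + 1 : ℤ))
            - intCoeff F (p i - ((j : ℕ) + 1 : ℤ) + 2 * ((l + 1 : ℕ) : ℤ)))) := by
  set f : ℤ → Fock R := intCoeff F with hf
  set v := zTrace R
  rw [mixedDet, RingHom.map_det]
  let a : Fin n → ℕ → Fock R[T;T⁻¹] := fun i j =>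
    doubleShift 1 (if j < l then MvPolynomial.C (intCoeff g (p i + ((j : ℕ) + 1 : ℤ) - mu j))
      else f (p i + ((j : ℕ) + 1 : ℤ)) - f (p i - ((j : ℕ) + 1 : ℤ) + 2 * l))
  let b : Fin n → ℕ → Fock R[T;T⁻¹] := fun i j =>
    if j ≤ l then a i j else a i j - v * a i (j - 1) + if l + 2 ≤ j then a i (j - 2) else 0
  refine (det_three_term_columns l v a b (fun i j hj => if_pos hj)
    (fun i j hj => if_neg (by omega))).symm.trans ?_
  congr 1
  ext1 i j
  simp only [Matrix.of_apply, b]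
  rcases lt_trichotomy (j : ℕ) l with h | h | h
  · rw [if_pos h.le, if_neg h.ne, if_pos (by omega)]
    simp only [a, if_pos h, doubleShift_C, MvPolynomial.map_C]
  · have e : p i - ((l : ℤ) + 1) + 2 * l = p i + (l + 1) - 2 := by ring
    rw [h]
    simp only [a, if_pos (le_refl l), if_neg (lt_irrefl l), if_true, e, map_sub]
  · rw [if_neg (not_le.2 h), if_neg (by omega : (j : ℕ) ≠ l),
      if_neg (by omega : ¬(j : ℕ) < l + 1), map_sub, hf, ← doubleShift_one_intCoeff hF,
      ← doubleShift_one_intCoeff hF, ← hf]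
    obtain ⟨d, hd⟩ := Nat.exists_eq_add_of_lt h
    rw [hd]
    simp only [a, Nat.add_sub_cancel]
    rw [if_neg (by omega), if_neg (by omega)]
    simp only [map_sub]
    have e1 : p i + (((l + d + 1 : ℕ) : ℤ) + 1) - 1 = p i + (((l + d : ℕ) : ℤ) + 1) := by
      push_cast; ring
    have e2 : p i - (((l + d + 1 : ℕ) : ℤ) + 1) + 2 * ((l + 1 : ℕ) : ℤ) - 1
        = p i - (((l + d : ℕ) : ℤ) + 1) + 2 * (l : ℤ) := by
      push_cast; ring
    have e3 : p i - (((l + d + 1 : ℕ) : ℤ) + 1) + 2 * ((l + 1 : ℕ) : ℤ) - 2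
        = p i - (((l + d + 1 : ℕ) : ℤ) + 1) + 2 * (l : ℤ) := by
      push_cast; ring
    rw [e1, e2, e3]
    -- For column `l + 1` the absent third term is `F(p i + l) - F(p i - l + 2l) = 0`.
    rcases Nat.eq_zero_or_pos d with rfl | hd'
    · have e4 : p i + (((l + 0 + 1 : ℕ) : ℤ) + 1) - 2
          = p i - (((l + 0 + 1 : ℕ) : ℤ) + 1) + 2 * ((l + 1 : ℕ) : ℤ) := by
        push_cast; ring
      rw [if_neg (by omega), e4]
      ring
    · have e4 : p i + (((l + d + 1 : ℕ) : ℤ) + 1) - 2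
          = p i + (((l + d + 1 - 2 : ℕ) : ℤ) + 1) := by omega
      have e5 : p i - (((l + d + 1 : ℕ) : ℤ) + 1) + 2 * ((l + 1 : ℕ) : ℤ)
          = p i - (((l + d + 1 - 2 : ℕ) : ℤ) + 1) + 2 * (l : ℤ) := by omega
      rw [if_pos (by omega), if_neg (by omega), e4, e5, map_sub]
      ring

theorem WStar_apply_mixedDet {n : ℕ} (mu : ℕ → ℕ) (p : Fin n → ℤ) (l : ℕ) (hl : l < n) :
    WStar (R := R) (-(mu l : ℤ))
        (mixedDet (fun k => MvPolynomial.C (intCoeff g k)) (intCoeff F) mu p l)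
      = mixedDet (fun k => MvPolynomial.C (intCoeff g k)) (intCoeff F) mu p (l + 1) := by
  rw [WStar, productCoeff_creationExp, map_one, one_mul, doubleShift_one_mixedDet hF]
  refine map_det_of_column (MvPolynomial.map LaurentPolynomial.C)
    (vertexMode (vertexSeries (-1 : R)) (-(mu l : ℤ))).toAddMonoidHom
    (vertexMode_map_C_mul (vertexSeries (-1 : R)) (-(mu l : ℤ))) ⟨l, hl⟩ _ _ ?_ ?_
  · intro i j hj
    exact if_neg fun h => hj (Fin.ext h)
  · intro i
    simp only [Matrix.of_apply, if_true, if_pos (Nat.lt_succ_self l)]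
    exact (vertexMode_doubleShift_one_sub hF _ _).symm

theorem prod_WStar_apply_mixedDet {n : ℕ} (mu : ℕ → ℕ) (p : Fin n → ℤ) (l : ℕ) (hl : l ≤ n) :
    (List.ofFn fun i : Fin l => WStar (R := R) (-(mu i.rev : ℤ))).prod
        (mixedDet (fun k => MvPolynomial.C (intCoeff g k)) (intCoeff F) mu p 0)
      = mixedDet (fun k => MvPolynomial.C (intCoeff g k)) (intCoeff F) mu p l := by
  induction l with
  | zero => simp
  | succ l ih =>
    -- The head of the list carries the last part of `μ` and acts last, so removing it leaves the
    -- product for the first `l` parts.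
    rw [List.ofFn_succ, List.prod_cons, Module.End.mul_apply]
    have h : (fun i : Fin l => WStar (R := R) (-(mu (Fin.rev i.succ) : ℤ)))
        = fun i : Fin l => WStar (R := R) (-(mu i.rev : ℤ)) := by
      funext i
      rw [Fin.rev_succ, Fin.val_castSucc]
    rw [h, ih (by omega), Fin.rev_zero, Fin.val_last]
    exact WStar_apply_mixedDet hF mu p l (by omega)

end Bra

/-- The vacuum functional kills every `a_{-n}`, hence the whole exponent. -/
theorem map_constantCoeff_vertexSeries (ε : R) :
    PowerSeries.map (MvPolynomial.constantCoeff (σ := ℕ+)) (vertexSeries ε) = 1 := by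
  have h : PowerSeries.map (MvPolynomial.constantCoeff (σ := ℕ+))
      (PowerSeries.C (MvPolynomial.C ε) * logSeries (fockVar R)) = 0 := by
    ext1 n
    rw [PowerSeries.coeff_map, PowerSeries.coeff_C_mul, logSeries, PowerSeries.coeff_mk, map_mul,
      map_mul, fockVar]
    split_ifs
    · erw [MvPolynomial.constantCoeff_X]
      rw [mul_zero, mul_zero, map_zero]
    · rw [map_zero, mul_zero, mul_zero, map_zero]
  rw [vertexSeries, map_expSeries, h]
  exact eq_one_of_derivative_eq_zero (by rw [derivative_expSeries (map_zero _), map_zero, zero_mul])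
    (constantCoeff_expSeries _)

omit [Algebra ℚ R] in
theorem map_mixedDet {A B : Type*} [CommRing A] [CommRing B] (φ : A →+* B) {n : ℕ} (g f : ℤ → A)
    (mu : ℕ → ℕ) (p : Fin n → ℤ) (l : ℕ) :
    φ (mixedDet g f mu p l) = mixedDet (fun k => φ (g k)) (fun k => φ (f k)) mu p l := by
  rw [mixedDet, RingHom.map_det, mixedDet]
  congr 1
  ext i j
  simp only [RingHom.mapMatrix_apply, Matrix.map_apply, Matrix.of_apply]
  split_ifs <;> simp

theorem skewOrthogonalSchur_eq_mixedDet {n l N : ℕ} (hl : l ≤ n) (x : Fin N → Rˣ)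
    (lam : Fin n → ℕ) (mu : ℕ → ℕ) :
    skewOrthogonalSchur x lam (fun i : Fin l => mu i)
      = mixedDet (hPM x) (hPM x) mu (fun i => (lam i : ℤ) - ((i : ℕ) + 1 : ℤ)) l := by
  obtain ⟨φ, hφ, hφH⟩ := exists_algHom_GammaPM x
  set Q : PowerSeries R := ∏ i, (1 - PowerSeries.C ((x i : Rˣ) : R) * PowerSeries.X) *
        (1 - PowerSeries.C (((x i)⁻¹ : Rˣ) : R) * PowerSeries.X)
  have hQ : Q * PowerSeries.invOfUnit Q 1 = 1 :=
    PowerSeries.mul_invOfUnit Q 1 (by simp [Q, map_prod])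
  set g := PowerSeries.invOfUnit Q 1
  have hg : intCoeff g = hPM x := rfl
  have hF : PowerSeries.map φ.toRingHom (vertexSeries 1)
      = vertexSeries 1 * PowerSeries.map MvPolynomial.C g := by
    calc PowerSeries.map φ.toRingHom (vertexSeries 1)
        = PowerSeries.map φ.toRingHom (vertexSeries 1) *
            PowerSeries.map MvPolynomial.C (Q * g) := by
          rw [hQ, map_one, mul_one]
      _ = _ := by rw [map_mul, ← mul_assoc, hφH]
  have hket : GammaPM x (ketO lam) = mixedDet (fun k => MvPolynomial.C (intCoeff g k))
      (intCoeff (PowerSeries.map φ.toRingHom (vertexSeries 1))) mu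
      (fun i => (lam i : ℤ) - ((i : ℕ) + 1 : ℤ)) 0 := by
    -- At `l = 0` no column reads the first argument or `mu`, so both are free to be chosen for the
    -- later steps.
    have h : orthogonalDet (intCoeff (vertexSeries 1)) (fun i => (lam i : ℤ) - ((i : ℕ) + 1 : ℤ))
        = mixedDet (intCoeff (vertexSeries 1)) (intCoeff (vertexSeries (1 : R))) mu
          (fun i => (lam i : ℤ) - ((i : ℕ) + 1 : ℤ)) 0 := by
      simp [orthogonalDet, mixedDet]
    rw [hφ, ketO_eq_orthogonalDet, h]
    refine (map_mixedDet φ.toRingHom _ _ _ _ _).trans ?_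
    simp [mixedDet, intCoeff_map]
  rw [skewOrthogonalSchur, hket, braO, LinearMap.comp_apply, prod_WStar_apply_mixedDet hF _ _ _ hl]
  -- The vacuum functional is the constant coefficient, a ring map, so it passes inside the
  -- determinant.
  refine (map_mixedDet (MvPolynomial.constantCoeff : Fock R →+* R) _ _ _ _ _).trans ?_
  congr 1
  · funext k
    rw [MvPolynomial.constantCoeff_C, hg]
  · funext k
    rw [← intCoeff_map, hF, map_mul, map_constantCoeff_vertexSeries, one_mul, ← hg]
    congr 1
    ext1 n
    simp

end Skew

end

end FockSpace

theorem proposition3p8 {R : Type*} [CommRing R] [Algebra ℚ R] (l N : ℕ)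
    (x : Fin N → Rˣ)
    (mu : Fin l → ℕ) (hmu : Antitone mu)
    (lam : Fin (l + N) → ℕ) (hlam : Antitone lam) :
    FockSpace.skewOrthogonalSchur x lam mu =
      Matrix.det (Matrix.of fun i j : Fin (l + N) =>
        if hj : (j : ℕ) < l then
          FockSpace.hPM x ((lam i : ℤ) - (mu ⟨j, hj⟩ : ℤ) - ((i : ℤ) + 1) + ((j : ℤ) + 1))
        else
          FockSpace.hPM x ((lam i : ℤ) - ((i : ℤ) + 1) + ((j : ℤ) + 1))
            - FockSpace.hPM x ((lam i : ℤ) - ((i : ℤ) + 1) - ((j : ℤ) + 1) + 2 * (l : ℤ))) := by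
  -- `mu` is extended by 0 to all of ℕ so that `l` could vary in the induction; values beyond `l`
  -- are never read.
  have h := FockSpace.skewOrthogonalSchur_eq_mixedDet (Nat.le_add_right l N) x lam
    fun k => if hk : k < l then mu ⟨k, hk⟩ else 0
  simp only [Fin.is_lt, dif_pos, Fin.eta] at h
  rw [h, FockSpace.mixedDet]
  congr 1
  ext i j
  simp only [Matrix.of_apply]
  split_ifs with hj
  · congr 1
    ring
  · rfl
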